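/- Let $k$ be a field. An arrangement $\mathcal{A}=(\mathcal{I},V,a)$ over $k$ consists of a finite set $\mathcal{I}$, a finite dimensional $k$-vector space $V$ and a map $a:\mathcal{I}\to V^*\smallsetminus\{0\}$ whose image spans $V^*$. Let $U_{\mathcal{A}}\subset V$ be the open subscheme where all $a(i)$ are nonzero, and let the reciprocal plane $X_{\mathcal{A}}$ be the (reduced) Zariski closure in the affine space $k^{\mathcal{I}}$ of the image of $U_{\mathcal{A}}$ under $v\mapsto (a(i)(v)^{-1})_{i\in\mathcal{I}}$; equivalently $X_{\mathcal A}$ is the spectrum of the subalgebra of $k(V)$ generated by the $a(i)^{-1}$. Write $u_i$ for the coordinates on $k^{\mathcal I}$. A set $S\subset\mathcal I$ is independent in the matroid $M_{\mathcal A}$ if $a$ is injective on $S$ with linearly independent image. For a flat $F$ of $M_{\mathcal A}$ let $V^F=\{v\in V\mid a(i)(v)=0 \text{ for all } i\in F\}$ and let the restriction $\mathcal{A}^F$ be the arrangement $(\mathcal{I}\smallsetminus F, V^F, a^F)$ with $a^F(j)=a(j)|_{V^F}$. Let $W_{\mathcal A,F}\subset X_{\mathcal A}$ be the open subscheme where $u_i\neq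 0$ for all $i\in F$, and let $X_{\mathcal A,F}\subset X_{\mathcal A}$ be the stratum of points at which $u_i$ vanishes if and only if $i\notin F$, a locally closed subscheme with its reduced structure. **Theorem.** Let $F$ be a flat of $\mathcal A$ and let $x$ be a point of the scheme $X_{\mathcal A,F}$. Then there are an open subscheme $\mathring{W}_{\mathcal A,F}\subset W_{\mathcal A,F}$ containing $x$ and a morphism of $k$-schemes $$\Phi:\mathring{W}_{\mathcal A,F}\to X_{\mathcal A^F}\times_k X_{\mathcal A,F}$$ such that $\Phi(x)=(0,x)$ (as points with values in the residue field of $x$, where $0$ is the origin of $k^{\mathcal I\smallsetminus F}$, which lies in $X_{\mathcal A^F}$) and $\Phi$ is étale at $x$. -/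

import Mathlib

open CategoryTheory CategoryTheory.Limits AlgebraicGeometry

universe u v

/-- An arrangement over `k` with (finite) index set `I` in the finite dimensional space `V`:
a family of nonzero linear functionals that spans the dual space. -/
structure Arrangement (k : Type u) (I : Type u) (V : Type v) [Field k] [Finite I]
    [AddCommGroup V] [Module k V] [FiniteDimensional k V] where
  /-- the functionals -/
  a : I → Module.Dual k V
  ne_zero : ∀ i, a i ≠ 0
  span_eq_top : Submodule.span k (Set.range a) = ⊤

namespace Arrangement

noncomputable section

variable {k : Type u} {I : Type u} {V : Type v} [Field k] [Finite I]
  [AddCommGroup V] [Module k V] [FiniteDimensional k V]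

/-! ### The matroid and the restriction to a flat -/

theorem indep_augment (A : Arrangement k I V) {S T : Set I} (hS : LinearIndepOn k A.a S)
    (hT : LinearIndepOn k A.a T) (h : S.ncard < T.ncard) :
    ∃ e ∈ T, e ∉ S ∧ LinearIndepOn k A.a (insert e S) := by
  classical
  by_contra! hcon
  have hsub : A.a '' T ⊆ Submodule.span k (A.a '' S) := by
    rintro _ ⟨e, he, rfl⟩
    by_contra hn
    have h1 := hS.notMem_span_iff.1 hn
    exact hcon e he h1.2 h1.1
  have hle := Submodule.span_le.2 hsub
  have hfin := Submodule.finrank_mono hle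
  have e1 : Module.finrank k (Submodule.span k (A.a '' S)) = S.ncard := by
    have := Fintype.ofFinite S
    rw [Set.image_eq_range, finrank_span_eq_card hS, ← Nat.card_eq_fintype_card,
      Nat.card_coe_set_eq]
  have e2 : Module.finrank k (Submodule.span k (A.a '' T)) = T.ncard := by
    have := Fintype.ofFinite T
    rw [Set.image_eq_range, finrank_span_eq_card hT, ← Nat.card_eq_fintype_card,
      Nat.card_coe_set_eq]
  omega

/-- The matroid represented by the arrangement: a set of indices is independent if the functionals
indexed by it are pairwise distinct and linearly independent. -/
def matroid (A : Arrangement k I V) : Matroid I :=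
  (IndepMatroid.ofFinite (E := Set.univ) Set.finite_univ (fun S => LinearIndepOn k A.a S)
    (linearIndepOn_empty k A.a) (fun _ _ hJ h => hJ.mono h)
    (fun _ _ hS hT h => A.indep_augment hS hT h) (fun _ _ => Set.subset_univ _)).matroid

theorem matroid_indep_iff (A : Arrangement k I V) (S : Set I) :
    A.matroid.Indep S ↔ LinearIndepOn k A.a S := by
  simp [matroid]

theorem matroid_E (A : Arrangement k I V) : A.matroid.E = Set.univ := rfl

/-- A functional whose index lies outside of a flat is not in the span of the flat. -/
theorem notMem_span_of_isFlat (A : Arrangement k I V) {F : Set I} (hF : A.matroid.IsFlat F)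
    {j : I} (hj : j ∉ F) : A.a j ∉ Submodule.span k (A.a '' F) := by
  intro hmem
  obtain ⟨B, hB⟩ := A.matroid.exists_isBasis F (Set.subset_univ _)
  have hBi := (A.matroid_indep_iff B).1 hB.indep
  have hspan : A.a '' F ⊆ Submodule.span k (A.a '' B) := by
    rintro _ ⟨e, he, rfl⟩
    by_contra hn
    have h1 := hBi.notMem_span_iff.1 hn
    exact h1.2 (hB.mem_of_insert_indep he ((A.matroid_indep_iff _).2 h1.1))
  have hj' : A.a j ∈ Submodule.span k (A.a '' B) := Submodule.span_le.2 hspan hmem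
  have hj2 : j ∈ A.matroid.closure B := by
    rw [hB.indep.mem_closure_iff' ]
    refine ⟨Set.mem_univ _, fun h => ?_⟩
    exact hBi.mem_span_iff.1 hj' ((A.matroid_indep_iff _).1 h)
  have hbas : A.matroid.IsBasis B (insert j F) := by
    refine hB.indep.isBasis_of_subset_of_subset_closure
      (hB.subset.trans (Set.subset_insert _ _)) ?_
    exact Set.insert_subset hj2 hB.subset_closure
  exact hj (hF.subset_of_isBasis_of_isBasis hB hbas (Set.mem_insert _ _))

/-- The subspace `V^F` of `V` on which all functionals indexed by `F` vanish. -/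
def flatSpace (A : Arrangement k I V) (F : Set I) : Submodule k V :=
  (Submodule.span k (A.a '' F)).dualCoannihilator

/-- The restriction `A^F` of an arrangement at a flat `F`: the functionals indexed by the complement
of `F`, restricted to `V^F`. -/
def restriction (A : Arrangement k I V) (F : Set I) (hF : A.matroid.IsFlat F) :
    Arrangement k (Fᶜ : Set I) (A.flatSpace F) where
  a j := (A.a j).domRestrict (A.flatSpace F)
  ne_zero j h := by
    refine A.notMem_span_of_isFlat hF j.2 ?_
    rw [← Subspace.dualCoannihilator_dualAnnihilator_eq (W := Submodule.span k (A.a '' F)),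
      Submodule.mem_dualAnnihilator]
    intro w hw
    exact LinearMap.congr_fun h ⟨w, hw⟩
  span_eq_top := by
    have hsurj := Subspace.dualRestrict_surjective (W := A.flatSpace F)
    rw [eq_top_iff, ← LinearMap.range_eq_top.2 hsurj, LinearMap.range_eq_map, ← A.span_eq_top,
      Submodule.map_span, Submodule.span_le]
    rintro _ ⟨_, ⟨i, rfl⟩, rfl⟩
    by_cases hi : i ∈ F
    · have h0 : (A.flatSpace F).dualRestrict (A.a i) = 0 := by
        ext w
        exact (Submodule.mem_dualCoannihilator _).1 w.2 _
          (Submodule.subset_span (Set.mem_image_of_mem _ hi))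
      rw [h0]
      exact Submodule.zero_mem _
    · exact Submodule.subset_span ⟨⟨i, hi⟩, rfl⟩

/-! ### The reciprocal plane -/

/-- The multiplicative set generated by the functionals, in the ring `Sym V^*` of regular functions
on `V`. -/
def denominators (A : Arrangement k I V) :
    Submonoid (SymmetricAlgebra k (Module.Dual k V)) :=
  Submonoid.closure (Set.range fun i => SymmetricAlgebra.ι k (Module.Dual k V) (A.a i))

/-- The ring of regular functions on the complement `U_A`: the ring `Sym V^*` of regular functions
on `V` with all the functionals of the arrangement inverted. -/
abbrev complementRing (A : Arrangement k I V) : Type (max u v) :=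
  Localization A.denominators

/-- The functional `a i` as an invertible function on the complement. -/
def functionalUnit (A : Arrangement k I V) (i : I) : A.complementRingˣ :=
  (IsLocalization.map_units A.complementRing
    (⟨SymmetricAlgebra.ι k (Module.Dual k V) (A.a i),
      Submonoid.subset_closure ⟨i, rfl⟩⟩ : A.denominators)).unit

/-- The pullback of polynomial functions on `k^I` along the map `U_A → k^I` with coordinates
`(a i)⁻¹`, the image of which is `U_A⁻¹`. -/
def reciprocalHom (A : Arrangement k I V) : MvPolynomial I k →ₐ[k] A.complementRing :=
  MvPolynomial.aeval fun i => ((A.functionalUnit i)⁻¹ : A.complementRingˣ).val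

/-- The ideal of the polynomial functions on `k^I` that vanish on `U_A⁻¹`. -/
def vanishingIdeal (A : Arrangement k I V) : Ideal (MvPolynomial I k) :=
  RingHom.ker A.reciprocalHom

/-- The vanishing ideal cuts out the closure of the image of `U_A → k^I`, `v ↦ ((a i v)⁻¹)`. -/
theorem zeroLocus_vanishingIdeal (A : Arrangement k I V) :
    PrimeSpectrum.zeroLocus (A.vanishingIdeal : Set (MvPolynomial I k)) =
      closure (Set.range (PrimeSpectrum.comap A.reciprocalHom.toRingHom)) :=
  (PrimeSpectrum.closure_range_comap _).symm

/-- The coordinate ring of the closure of `U_A⁻¹` in `k^I` (the Orlik-Terao algebra). -/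
def coordRing (A : Arrangement k I V) : Type u :=
  MvPolynomial I k ⧸ A.vanishingIdeal

instance (A : Arrangement k I V) : CommRing A.coordRing :=
  Ideal.Quotient.commRing A.vanishingIdeal

instance (A : Arrangement k I V) : Algebra k A.coordRing :=
  Ideal.Quotient.algebra k

/-- The restriction of polynomial functions from `k^I` to the reciprocal plane. -/
def toCoordRing (A : Arrangement k I V) : MvPolynomial I k →ₐ[k] A.coordRing :=
  Ideal.Quotient.mkₐ k A.vanishingIdeal

/-- The `i`-th coordinate function on the reciprocal plane. -/
def coord (A : Arrangement k I V) (i : I) : A.coordRing :=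
  A.toCoordRing (MvPolynomial.X i)

/-- The reciprocal plane `X_A`: the Zariski closure of `U_A⁻¹` in the affine space `k^I`. -/
abbrev recipPlane (A : Arrangement k I V) : Scheme.{u} :=
  Spec (.of A.coordRing)

/-- The structure morphism of the reciprocal plane. -/
def recipPlaneToBase (A : Arrangement k I V) : A.recipPlane ⟶ Spec (.of k) :=
  Spec.map (CommRingCat.ofHom (algebraMap k A.coordRing))

/-! ### The origin of the reciprocal plane -/

theorem ι_ne_zero {k : Type u} {V : Type v} [Field k] [AddCommGroup V] [Module k V] {m : Module.Dual k V} (hm : m ≠ 0) :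
    SymmetricAlgebra.ι k (Module.Dual k V) m ≠ 0 := by
  intro h
  obtain ⟨w, hw⟩ : ∃ w, m w ≠ 0 := by
    by_contra! hcon
    exact hm (LinearMap.ext hcon)
  have h2 := congrArg (SymmetricAlgebra.lift (Module.Dual.eval k V w)) h
  rw [SymmetricAlgebra.lift_ι_apply, map_zero] at h2
  exact hw h2

instance (A : Arrangement k I V) : Nontrivial A.complementRing := by
  refine (IsLocalization.injective A.complementRing (M := A.denominators) ?_).nontrivial
  refine Submonoid.closure_le.2 ?_
  rintro _ ⟨i, rfl⟩
  exact mem_nonZeroDivisors_of_ne_zero (ι_ne_zero (A.ne_zero i))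

/-- Polynomials that vanish on `U_A⁻¹` have no constant term, so that the origin lies in the
reciprocal plane. -/
theorem constantCoeff_of_mem (A : Arrangement k I V) {f : MvPolynomial I k}
    (hf : f ∈ A.vanishingIdeal) : MvPolynomial.constantCoeff f = 0 := by
  let R := A.complementRing
  let L := LaurentPolynomial R
  let ψ₀ : SymmetricAlgebra k (Module.Dual k V) →ₐ[k] L :=
    SymmetricAlgebra.lift (A := L)
      ((LinearMap.mulRight k (LaurentPolynomial.T (-1) : L)).comp
        ((IsScalarTower.toAlgHom k R L).toLinearMap.comp
          ((IsScalarTower.toAlgHom k (SymmetricAlgebra k (Module.Dual k V)) R).toLinearMap.comp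
            (SymmetricAlgebra.ι k (Module.Dual k V)))))
  have hψ₀ (m) : ψ₀ (SymmetricAlgebra.ι k (Module.Dual k V) m) =
      algebraMap R L (algebraMap _ R (SymmetricAlgebra.ι k (Module.Dual k V) m)) *
        LaurentPolynomial.T (-1) := by
    simp only [ψ₀, SymmetricAlgebra.lift_ι_apply]
    rfl
  have hunit : ∀ y : A.denominators, IsUnit (ψ₀.toRingHom y) := by
    rintro ⟨y, hy⟩
    induction hy using Submonoid.closure_induction with
    | mem x hx =>
      obtain ⟨i, rfl⟩ := hx
      change IsUnit (ψ₀ _)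
      rw [hψ₀]
      exact ((A.functionalUnit i).isUnit.map (algebraMap R L)).mul
        (LaurentPolynomial.isUnit_T (-1))
    | one => simp
    | mul x y _ _ hx hy =>
      have : ψ₀.toRingHom (x * y) = ψ₀.toRingHom x * ψ₀.toRingHom y := map_mul _ _ _
      change IsUnit (ψ₀.toRingHom (x * y))
      rw [this]
      exact hx.mul hy
  let ψ : R →+* L := IsLocalization.lift hunit
  have hψ (i : I) : ψ ((A.functionalUnit i)⁻¹ : Rˣ).val =
      Polynomial.toLaurent (Polynomial.C ((A.functionalUnit i)⁻¹ : Rˣ).val * Polynomial.X) := by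
    have h1 : ψ (A.functionalUnit i).val =
        algebraMap R L (A.functionalUnit i).val * LaurentPolynomial.T (-1) := by
      exact (IsLocalization.lift_eq hunit _).trans (hψ₀ _)
    have h2 : ψ ((A.functionalUnit i)⁻¹ : Rˣ).val * ψ (A.functionalUnit i).val = 1 := by
      rw [← map_mul, Units.inv_mul, map_one]
    have h3 : Polynomial.toLaurent
        (Polynomial.C ((A.functionalUnit i)⁻¹ : Rˣ).val * Polynomial.X) *
          ψ (A.functionalUnit i).val = 1 := by
      rw [h1, map_mul, Polynomial.toLaurent_C, Polynomial.toLaurent_X]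
      have : algebraMap R L (A.functionalUnit i).val =
        LaurentPolynomial.C (A.functionalUnit i).val := rfl
      rw [this]
      refine (mul_mul_mul_comm (G := L) _ _ _ _).trans ?_
      rw [← map_mul, Units.inv_mul, map_one, ← LaurentPolynomial.T_add]
      simp
    have hu : IsUnit (ψ (A.functionalUnit i).val) := (A.functionalUnit i).isUnit.map ψ
    exact hu.mul_right_cancel (h2.trans h3.symm)
  let g : MvPolynomial I k →+* Polynomial R :=
    MvPolynomial.eval₂Hom (algebraMap k (Polynomial R))
      fun i => Polynomial.C ((A.functionalUnit i)⁻¹ : Rˣ).val * Polynomial.X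
  have hcomp : ψ.comp A.reciprocalHom.toRingHom = Polynomial.toLaurent.comp g := by
    apply MvPolynomial.ringHom_ext
    · intro r
      have e1 : A.reciprocalHom.toRingHom (MvPolynomial.C r) = algebraMap _ R
          (algebraMap k (SymmetricAlgebra k (Module.Dual k V)) r) := by
        change MvPolynomial.aeval _ _ = _
        rw [MvPolynomial.aeval_C]
        exact IsScalarTower.algebraMap_apply _ _ _ _
      have e2 : ψ (algebraMap _ R (algebraMap k (SymmetricAlgebra k (Module.Dual k V)) r)) =
          ψ₀ (algebraMap k (SymmetricAlgebra k (Module.Dual k V)) r) :=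
        IsLocalization.lift_eq _ _
      rw [RingHom.comp_apply, RingHom.comp_apply, e1, e2, AlgHom.commutes]
      simp only [g, MvPolynomial.coe_eval₂Hom, MvPolynomial.eval₂_C]
      rw [IsScalarTower.algebraMap_apply k R (Polynomial R), Polynomial.algebraMap_eq,
        Polynomial.toLaurent_C, IsScalarTower.algebraMap_apply k R L]
      rfl
    · intro i
      have e1 : A.reciprocalHom.toRingHom (MvPolynomial.X i) =
          ((A.functionalUnit i)⁻¹ : Rˣ).val := by
        change MvPolynomial.aeval _ _ = _
        rw [MvPolynomial.aeval_X]
      rw [RingHom.comp_apply, RingHom.comp_apply, e1, hψ]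
      simp [g]
  have hg0 : g f = 0 := by
    apply Polynomial.toLaurent_injective
    have := RingHom.congr_fun hcomp f
    rw [RingHom.comp_apply, RingHom.comp_apply] at this
    rw [← this, map_zero]
    have h0 : A.reciprocalHom.toRingHom f = 0 := hf
    rw [h0, map_zero]
  have hconst : (Polynomial.constantCoeff (R := R)).comp g =
      (algebraMap k R).comp MvPolynomial.constantCoeff := by
    apply MvPolynomial.ringHom_ext
    · intro r
      simp only [g, RingHom.comp_apply, MvPolynomial.coe_eval₂Hom, MvPolynomial.eval₂_C,
        MvPolynomial.constantCoeff_C]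
      rw [IsScalarTower.algebraMap_apply k R (Polynomial R), Polynomial.algebraMap_eq]
      simp
    · intro i
      simp [g]
  have := RingHom.congr_fun hconst f
  rw [RingHom.comp_apply, RingHom.comp_apply, hg0, map_zero] at this
  exact (map_eq_zero (algebraMap k R)).1 this.symm

/-- Evaluation at the origin of `k^I` of functions on the reciprocal plane. -/
def evalZero (A : Arrangement k I V) : A.coordRing →+* k :=
  Ideal.Quotient.lift A.vanishingIdeal MvPolynomial.constantCoeff
    fun _ hf => A.constantCoeff_of_mem hf

/-- The origin `0` of `k^I`, as a `k`-rational point of the reciprocal plane: all coordinate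
functions are evaluated at zero. -/
def origin (A : Arrangement k I V) : Spec (.of k) ⟶ A.recipPlane :=
  Spec.map (CommRingCat.ofHom A.evalZero)

/-! ### Strata -/

/-- The open subscheme `W_{A,F}` of the reciprocal plane defined by the nonvanishing of the
coordinates indexed by `F`. -/
def openStar (A : Arrangement k I V) (F : Set I) : A.recipPlane.Opens where
  carrier := {y : PrimeSpectrum A.coordRing | ∀ i : F, A.coord i ∉ y.asIdeal}
  is_open' := by
    have : {y : PrimeSpectrum A.coordRing | ∀ i : F, A.coord i ∉ y.asIdeal} =
        ⋂ i : F, (PrimeSpectrum.basicOpen (A.coord i) : Set (PrimeSpectrum A.coordRing)) := by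
      ext y
      simp
    exact this ▸ isOpen_iInter_of_finite fun i : F => (PrimeSpectrum.basicOpen (A.coord i)).isOpen

/-- The ideal of the functions on `X_A` that vanish on the closed locus where all the coordinates
that are not indexed by `F` vanish. -/
def stratumIdeal (A : Arrangement k I V) (F : Set I) : Ideal A.coordRing :=
  (Ideal.span (A.coord '' Fᶜ)).radical

/-- The coordinate ring of the reduced closed subscheme of `X_A` on which the coordinates that are
not indexed by `F` vanish. -/
def closedStratumRing (A : Arrangement k I V) (F : Set I) : Type u :=
  A.coordRing ⧸ A.stratumIdeal F

instance (A : Arrangement k I V) (F : Set I) : CommRing (A.closedStratumRing F) :=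
  Ideal.Quotient.commRing (A.stratumIdeal F)

/-- The restriction of functions from `X_A` to that closed subscheme. -/
def toClosedStratumRing (A : Arrangement k I V) (F : Set I) :
    A.coordRing →+* A.closedStratumRing F :=
  Ideal.Quotient.mk (A.stratumIdeal F)

/-- The coordinate ring of the stratum `X_{A,F}`: the coordinates indexed by `F` are inverted in the
coordinate ring of the reduced locus where the other coordinates vanish. -/
abbrev stratumRing (A : Arrangement k I V) (F : Set I) : Type u :=
  Localization (Submonoid.closure
    (Set.range fun i : F => A.toClosedStratumRing F (A.coord i)))

/-- The stratum `X_{A,F}`, with its reduced structure: the locus in the reciprocal plane where the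
`i`-th coordinate vanishes if and only if `i ∉ F`. -/
abbrev stratum (A : Arrangement k I V) (F : Set I) : Scheme.{u} :=
  Spec (.of (A.stratumRing F))

/-- The inclusion of the stratum `X_{A,F}` into the reciprocal plane. -/
def stratumι (A : Arrangement k I V) (F : Set I) : A.stratum F ⟶ A.recipPlane :=
  Spec.map (CommRingCat.ofHom
    ((algebraMap (A.closedStratumRing F) (A.stratumRing F)).comp (A.toClosedStratumRing F)))

/-- The structure morphism of the stratum. -/
def stratumToBase (A : Arrangement k I V) (F : Set I) : A.stratum F ⟶ Spec (.of k) :=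
  A.stratumι F ≫ A.recipPlaneToBase

/-- The points of the stratum are the points of the reciprocal plane whose `i`-th coordinate
vanishes if and only if `i ∉ F`. -/
theorem range_stratumι (A : Arrangement k I V) (F : Set I) :
    Set.range (A.stratumι F) =
      {y : PrimeSpectrum A.coordRing | ∀ i, A.coord i ∈ y.asIdeal ↔ i ∉ F} := by
  set M := Submonoid.closure
    (Set.range fun i : F => A.toClosedStratumRing F (A.coord i)) with hM
  have h1 : Set.range (A.stratumι F) =
      PrimeSpectrum.comap (A.toClosedStratumRing F) ''
        {p : PrimeSpectrum (A.closedStratumRing F) |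
          Disjoint (M : Set (A.closedStratumRing F)) p.asIdeal} := by
    rw [← PrimeSpectrum.localization_comap_range (A.stratumRing F) M, ← Set.range_comp]
    rfl
  rw [h1]
  have hdisj (p : PrimeSpectrum (A.closedStratumRing F)) :
      Disjoint (M : Set (A.closedStratumRing F)) p.asIdeal ↔
        ∀ i ∈ F, A.toClosedStratumRing F (A.coord i) ∉ p.asIdeal := by
    constructor
    · intro h i hi hmem
      exact Set.disjoint_left.1 h (Submonoid.subset_closure ⟨⟨i, hi⟩, rfl⟩) hmem
    · intro h
      have : M ≤ p.asIdeal.primeCompl := by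
        refine Submonoid.closure_le.2 ?_
        rintro _ ⟨i, rfl⟩
        exact h i i.2
      exact Set.disjoint_left.2 fun z hz => this hz
  ext y
  constructor
  · rintro ⟨p, hp, rfl⟩ i
    constructor
    · exact fun h hi => (hdisj p).1 hp i hi h
    · intro hi
      change A.toClosedStratumRing F (A.coord i) ∈ p.asIdeal
      have : A.coord i ∈ A.stratumIdeal F :=
        Ideal.le_radical (Ideal.subset_span (Set.mem_image_of_mem _ hi))
      rw [show A.toClosedStratumRing F (A.coord i) = 0 from Ideal.Quotient.eq_zero_iff_mem.2 this]
      exact zero_mem _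
  · intro hy
    have hle : A.stratumIdeal F ≤ PrimeSpectrum.asIdeal y := by
      refine Ideal.IsPrime.radical_le_iff (PrimeSpectrum.isPrime y) |>.2 (Ideal.span_le.2 ?_)
      rintro _ ⟨i, hi, rfl⟩
      exact (hy i).2 hi
    have hr : y ∈ Set.range (PrimeSpectrum.comap (A.toClosedStratumRing F)) := by
      rw [range_comap_of_surjective _ (A.toClosedStratumRing F)
        Ideal.Quotient.mk_surjective, show RingHom.ker (A.toClosedStratumRing F) = A.stratumIdeal F
          from Ideal.mk_ker]
      exact hle
    obtain ⟨p, rfl⟩ := hr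
    exact ⟨p, (hdisj p).2 fun i hi h => (hy i).1 h hi, rfl⟩

/-- The product `X_{A^F} × X_{A,F}` over `k`. -/
abbrev sliceProduct (A : Arrangement k I V) (F : Set I) (hF : A.matroid.IsFlat F) : Scheme.{u} :=
  pullback (A.restriction F hF).recipPlaneToBase (A.stratumToBase F)

/-- The structure morphism of the product `X_{A^F} × X_{A,F}`. -/
def sliceProductToBase (A : Arrangement k I V) (F : Set I) (hF : A.matroid.IsFlat F) :
    A.sliceProduct F hF ⟶ Spec (.of k) :=
  pullback.snd (A.restriction F hF).recipPlaneToBase (A.stratumToBase F) ≫ A.stratumToBase F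

theorem origin_toBase (A : Arrangement k I V) :
    A.origin ≫ A.recipPlaneToBase = 𝟙 _ := by
  rw [origin, recipPlaneToBase, ← Spec.map_comp, ← CommRingCat.ofHom_comp]
  have : A.evalZero.comp (algebraMap k A.coordRing) = RingHom.id k := by
    ext r
    exact MvPolynomial.constantCoeff_C (σ := I) r
  rw [this]
  exact Spec.map_id _

/-- The morphism `X_{A,F} → X_{A^F} × X_{A,F}`, `x ↦ (0, x)`. -/
def zeroSection (A : Arrangement k I V) (F : Set I) (hF : A.matroid.IsFlat F) :
    A.stratum F ⟶ A.sliceProduct F hF :=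
  pullback.lift (A.stratumToBase F ≫ (A.restriction F hF).origin) (𝟙 _)
    (by rw [Category.assoc, origin_toBase, Category.comp_id, Category.id_comp])

end

end Arrangement

/-- A morphism of schemes is étale at a point if it is étale on an open neighbourhood of it. -/
def EtaleAt {X Y : Scheme.{u}} (f : X ⟶ Y) (x : X) : Prop :=
  ∃ U : X.Opens, x ∈ U ∧ Etale (U.ι ≫ f)

/-! Choose a projection `p` of `V^*` onto the span of `F`, that is, a complement of `V^F` in `V`.
For `j ∉ F` the functional `a j` is then the sum of `p (a j)` and a functional determined by its
restriction to `V^F`, which is nonzero because `F` is a flat. Where the coordinates `u_i`, `i ∈ F`,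
are invertible, `c_j = p (a j)` is a regular function pulled back from the stratum. In terms of `u_j
= 1 / a j` and `w_j = 1 / (a j - c_j)`, the splitting reads `w_j = u_j / (1 - c_j u_j)`, with
inverse `u_j = w_j / (1 + c_j w_j)`. Both formulas make sense at `u_j = 0`, respectively `w_j = 0`.
Hence `Φ = ((w_j), (u_i))` is an open immersion on the locus where all `u_i` and all `1 - c_j u_j`
are invertible. This locus contains the whole stratum, so one `Φ` serves every `x`, and étaleness
follows.

It remains to see that the formulas respect the relations of the coordinate rings. By
`exists_coordRing_algHom` this may be checked in a larger ring, where the coordinates are inverses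
of values of linear functionals. This yields `exists_restriction_algHom` and
`exists_coordRing_algHom_away`. Setting `w = 0` in the latter identifies the maps out of the stratum
(`exists_stratumRing_algHom`), and `isOpenImmersion_slice` checks that the two directions are
inverse. -/

section

/-! ### Localizations, and open immersions of affine schemes -/

open scoped TensorProduct

/-- An algebra homomorphism that inverts `a` extends to the localization away from `a`. -/
theorem Localization.exists_awayLift_algHom {k R B : Type*} [CommRing k] [CommRing R] [CommRing B]
    [Algebra k R] [Algebra k B] (f : R →ₐ[k] B) (a : R) (ha : IsUnit (f a)) :
    ∃ f' : Localization.Away a →ₐ[k] B, ∀ x, f' (algebraMap R _ x) = f x := by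
  have h : ∀ y : Submonoid.powers a, IsUnit (f y) := by
    rintro ⟨_, n, rfl⟩
    simpa using ha.pow n
  exact ⟨IsLocalization.liftAlgHom (M := Submonoid.powers a) h,
    fun x => IsLocalization.lift_eq (g := f.toRingHom) h x⟩

theorem Localization.awayMapₐ_algebraMap {k R B : Type*} [CommRing k] [CommRing R] [CommRing B]
    [Algebra k R] [Algebra k B] (f : R →ₐ[k] B) (a : R) (x : R) :
    Localization.awayMapₐ f a (algebraMap R _ x) = algebraMap B _ (f x) :=
  IsLocalization.lift_eq _ x

/-- Keeps a generic point of the reciprocal plane generic after a function is inverted. -/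
theorem Localization.awayMapₐ_injective {k R B : Type*} [CommRing k] [CommRing R] [CommRing B]
    [Algebra k R] [Algebra k B] (f : R →ₐ[k] B) (a : R) (hf : Function.Injective f) :
    Function.Injective (Localization.awayMapₐ f a) := by
  have : IsLocalization (Submonoid.map f.toRingHom (Submonoid.powers a))
      (Localization.Away (f a)) := by
    have : Submonoid.map f.toRingHom (Submonoid.powers a) = Submonoid.powers (f a) :=
      Submonoid.map_powers _ _
    rw [this]
    infer_instance
  exact IsLocalization.map_injective_of_injective (Submonoid.powers a) (Localization.Away a)
    (g := f.toRingHom) (Localization.Away (f a)) hf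

/-- Mutually inverse homomorphisms exhibit a localization as an open subscheme. -/
theorem AlgebraicGeometry.isOpenImmersion_specMap_of_away {P B : Type u} [CommRing P] [CommRing B]
    (φ : P →+* B) (h : P) (ψ : B →+* Localization.Away h) (χ : Localization.Away h →+* B)
    (hφ : χ.comp (algebraMap P _) = φ) (h₁ : ψ.comp χ = RingHom.id _)
    (h₂ : χ.comp ψ = RingHom.id _) : IsOpenImmersion (Spec.map (CommRingCat.ofHom φ)) := by
  let e : Localization.Away h ≃+* B := RingEquiv.ofRingHom χ ψ h₂ h₁
  have : Spec.map (CommRingCat.ofHom φ) = Spec.map e.toCommRingCatIso.hom ≫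
      Spec.map (CommRingCat.ofHom (algebraMap P (Localization.Away h))) := by
    rw [← Spec.map_comp, ← hφ]
    rfl
  rw [this]
  have : IsOpenImmersion (Spec.map (CommRingCat.ofHom (algebraMap P (Localization.Away h)))) :=
    IsOpenImmersion.of_isLocalization h
  infer_instance

theorem Algebra.TensorProduct.map_tmul_eq_mul {k S T P : Type*} [CommRing k] [CommRing S]
    [CommRing T] [CommRing P] [Algebra k S] [Algebra k T] [Algebra k P]
    (f : TensorProduct k S T →ₐ[k] P) (a : S) (b : T) :
    f (a ⊗ₜ b) = f (a ⊗ₜ 1) * f (1 ⊗ₜ b) := by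
  rw [← map_mul, Algebra.TensorProduct.tmul_mul_tmul, mul_one, one_mul]

/-- A morphism to a product of affine schemes is an open immersion if the corresponding homomorphism
from the tensor product defines one. -/
theorem AlgebraicGeometry.isOpenImmersion_pullbackLift_specMap {k S T B : Type u} [CommRing k]
    [CommRing S] [CommRing T] [CommRing B] [Algebra k S] [Algebra k T] [Algebra k B]
    (φ₁ : S →ₐ[k] B) (φ₂ : T →ₐ[k] B) (p : Spec (.of S) ⟶ Spec (.of k))
    (q : Spec (.of T) ⟶ Spec (.of k)) (hp : p = Spec.map (CommRingCat.ofHom (algebraMap k S)))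
    (hq : q = Spec.map (CommRingCat.ofHom (algebraMap k T)))
    (h : Spec.map (CommRingCat.ofHom φ₁.toRingHom) ≫ p =
      Spec.map (CommRingCat.ofHom φ₂.toRingHom) ≫ q)
    (hφ : IsOpenImmersion (Spec.map (CommRingCat.ofHom
      (Algebra.TensorProduct.lift φ₁ φ₂ fun _ _ => Commute.all _ _).toRingHom))) :
    IsOpenImmersion (pullback.lift _ _ h) := by
  subst hp hq
  have : pullback.lift _ _ h = Spec.map (CommRingCat.ofHom
      (Algebra.TensorProduct.lift φ₁ φ₂ fun _ _ => Commute.all _ _).toRingHom) ≫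
        (pullbackSpecIso k S T).inv := by
    apply pullback.hom_ext
    · rw [Category.assoc, pullbackSpecIso_inv_fst, ← Spec.map_comp,
        ← CommRingCat.ofHom_comp, pullback.lift_fst]
      exact congrArg (fun r => Spec.map (CommRingCat.ofHom r)) (RingHom.ext fun r => by simp)
    · rw [Category.assoc, pullbackSpecIso_inv_snd, ← Spec.map_comp,
        ← CommRingCat.ofHom_comp, pullback.lift_snd]
      exact congrArg (fun r => Spec.map (CommRingCat.ofHom r)) (RingHom.ext fun r => by simp)
  rw [this]
  infer_instance

end

namespace Arrangement

noncomputable section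

open scoped TensorProduct

variable {k : Type u} {I : Type u} {V : Type v} [Field k] [Finite I]
  [AddCommGroup V] [Module k V] [FiniteDimensional k V]

/-! ### Homomorphisms out of the coordinate ring -/

/-- The linear functions on `V`, as functions on the complement. -/
def linearFunction (A : Arrangement k I V) : Module.Dual k V →ₗ[k] A.complementRing :=
  (IsScalarTower.toAlgHom k (SymmetricAlgebra k (Module.Dual k V)) A.complementRing).toLinearMap ∘ₗ
    SymmetricAlgebra.ι k (Module.Dual k V)

theorem linearFunction_a (A : Arrangement k I V) (i : I) :
    A.linearFunction (A.a i) = (A.functionalUnit i).val := rfl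

/-- The inclusion of the coordinate ring of the reciprocal plane into the ring of functions on the
complement. -/
def toComplementRing (A : Arrangement k I V) : A.coordRing →ₐ[k] A.complementRing :=
  Ideal.Quotient.liftₐ A.vanishingIdeal A.reciprocalHom fun _ h => h

theorem toComplementRing_coord (A : Arrangement k I V) (i : I) :
    A.toComplementRing (A.coord i) = ((A.functionalUnit i)⁻¹ : A.complementRingˣ).val :=
  MvPolynomial.aeval_X _ _

theorem linearFunction_mul_coord (A : Arrangement k I V) (i : I) :
    A.linearFunction (A.a i) * A.toComplementRing (A.coord i) = 1 := by
  rw [linearFunction_a, toComplementRing_coord, Units.mul_inv]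

theorem toComplementRing_injective (A : Arrangement k I V) :
    Function.Injective A.toComplementRing := by
  rw [injective_iff_map_eq_zero]
  intro f hf
  obtain ⟨f, rfl⟩ := Ideal.Quotient.mk_surjective f
  exact Ideal.Quotient.eq_zero_iff_mem.2 hf

/-- The reciprocal plane has a generic point in the complement, over the ring of functions of the
complement. -/
theorem exists_generic_point (A : Arrangement k I V) :
    ∃ (C : Type (max u v)) (_ : CommRing C) (_ : Algebra k C) (t : A.coordRing →ₐ[k] C)
      (m : Module.Dual k V →ₗ[k] C), Function.Injective t ∧
        ∀ i, m (A.a i) * t (A.coord i) = 1 :=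
  ⟨A.complementRing, inferInstance, inferInstance, A.toComplementRing, A.linearFunction,
    A.toComplementRing_injective, A.linearFunction_mul_coord⟩

theorem coordRing_algHom_ext (A : Arrangement k I V) {B : Type*} [CommRing B] [Algebra k B]
    {f g : A.coordRing →ₐ[k] B} (h : ∀ i, f (A.coord i) = g (A.coord i)) : f = g :=
  Ideal.Quotient.algHom_ext _ (MvPolynomial.algHom_ext h)

/-- The coordinate ring embeds into a localization of the domain `Sym V^*`. -/
instance (A : Arrangement k I V) : _root_.IsReduced A.coordRing :=
  have : _root_.IsReduced A.complementRing :=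
    isReduced_localizationPreserves A.denominators _ inferInstance
  isReduced_of_injective A.toComplementRing A.toComplementRing_injective

/-- To give a homomorphism from the coordinate ring of the reciprocal plane to a ring `B` it is
enough to give, over a larger ring `Q`, a point of the complement the reciprocal coordinates of
which are in `B`. -/
theorem exists_coordRing_algHom (A : Arrangement k I V) {B Q : Type*} [CommRing B] [CommRing Q]
    [Algebra k B] [Algebra k Q] (j : B →ₐ[k] Q) (hj : Function.Injective j)
    (l : Module.Dual k V →ₗ[k] Q) (b : I → B) (h : ∀ i, l (A.a i) * j (b i) = 1) :
    ∃ f : A.coordRing →ₐ[k] B, ∀ i, f (A.coord i) = b i := by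
  have hunit : ∀ y : A.denominators, IsUnit (SymmetricAlgebra.lift l y) := by
    have : A.denominators ≤ (IsUnit.submonoid Q).comap (SymmetricAlgebra.lift l) := by
      refine Submonoid.closure_le.2 ?_
      rintro _ ⟨i, rfl⟩
      change IsUnit (SymmetricAlgebra.lift l _)
      rw [SymmetricAlgebra.lift_ι_apply]
      exact IsUnit.of_mul_eq_one _ (h i)
    exact fun y => this y.2
  let e : A.complementRing →ₐ[k] Q := IsLocalization.liftAlgHom (M := A.denominators) hunit
  have he (i : I) : e (A.functionalUnit i).val = l (A.a i) :=
    (IsLocalization.lift_eq (g := (SymmetricAlgebra.lift l).toRingHom) hunit _).trans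
      (SymmetricAlgebra.lift_ι_apply _ _)
  -- Inverses are unique, so both sides agree on the coordinates. Hence `j` after evaluation at `b`
  -- kills the kernel of `reciprocalHom`, and injectivity of `j` brings this down to `B`.
  have hcomp : e.comp A.reciprocalHom = j.comp (MvPolynomial.aeval b) := by
    refine MvPolynomial.algHom_ext fun i => ?_
    have h1 : l (A.a i) * e ((A.functionalUnit i)⁻¹ : A.complementRingˣ).val = 1 := by
      rw [← he, ← map_mul, Units.mul_inv, map_one]
    have h2 : e ((A.functionalUnit i)⁻¹ : A.complementRingˣ).val = j (b i) :=
      (IsUnit.of_mul_eq_one _ (h i)).mul_left_cancel (h1.trans (h i).symm)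
    simpa [reciprocalHom] using h2
  refine ⟨Ideal.Quotient.liftₐ A.vanishingIdeal (MvPolynomial.aeval b) fun f hf => ?_,
    fun i => MvPolynomial.aeval_X _ _⟩
  apply hj
  have h1 := DFunLike.congr_fun hcomp f
  have h2 : A.reciprocalHom f = 0 := hf
  rw [AlgHom.comp_apply, AlgHom.comp_apply, h2, map_zero] at h1
  rw [← h1, map_zero]

/-- Variant of `exists_coordRing_algHom` for homomorphisms to a localization, given by fractions. -/
theorem exists_coordRing_algHom_fractions (A : Arrangement k I V) {B Q : Type*} [CommRing B]
    [CommRing Q] [Algebra k B] [Algebra k Q] (t : B →ₐ[k] Q) (ht : Function.Injective t)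
    (m : Module.Dual k V →ₗ[k] Q) (n d : I → B) (h : ∀ i, m (A.a i) * t (n i) = t (d i)) (b : B)
    (hd : ∀ i, IsUnit (algebraMap B (Localization.Away b) (d i))) :
    ∃ f : A.coordRing →ₐ[k] Localization.Away b,
      ∀ i, f (A.coord i) * algebraMap _ _ (d i) = algebraMap _ _ (n i) := by
  choose c hc using fun i => (hd i).exists_right_inv
  obtain ⟨f, hf⟩ := A.exists_coordRing_algHom (Localization.awayMapₐ t b)
    (Localization.awayMapₐ_injective t b ht)
    ((IsScalarTower.toAlgHom k Q (Localization.Away (t b))).toLinearMap ∘ₗ m)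
    (fun i => algebraMap _ _ (n i) * c i) fun i => by
      rw [map_mul, Localization.awayMapₐ_algebraMap]
      change algebraMap Q (Localization.Away (t b)) _ * _ = _
      rw [← mul_assoc, ← map_mul, h, ← Localization.awayMapₐ_algebraMap, ← map_mul, hc, map_one]
  refine ⟨f, fun i => ?_⟩
  rw [hf, mul_assoc, mul_comm (c i), hc, mul_one]

/-! ### Functionals in the span of `F`, and a splitting of the dual space -/

/-- The span of the functionals indexed by `F`. -/
abbrev flatSpan (A : Arrangement k I V) (F : Set I) : Submodule k (Module.Dual k V) :=
  Submodule.span k (A.a '' F)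

/-- A functional indexed by `F`, as an element of the span. -/
def flatFunctional (A : Arrangement k I V) (F : Set I) (i : F) : A.flatSpan F :=
  ⟨A.a i, Submodule.subset_span (Set.mem_image_of_mem _ i.2)⟩

theorem flatSpan_linearMap_ext (A : Arrangement k I V) (F : Set I) {M : Type*} [AddCommMonoid M]
    [Module k M] {f g : A.flatSpan F →ₗ[k] M}
    (h : ∀ i, f (A.flatFunctional F i) = g (A.flatFunctional F i)) : f = g := by
  refine LinearMap.ext_on_range (v := A.flatFunctional F) ?_ h
  apply Submodule.map_injective_of_injective (A.flatSpan F).injective_subtype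
  rw [Submodule.map_span, Submodule.map_top, Submodule.range_subtype, ← Set.range_comp]
  congr 1
  ext m
  simp [flatFunctional]

/-- The product of the coordinates indexed by `F`. -/
def flatCoordProd (A : Arrangement k I V) (F : Set I) : A.coordRing :=
  ∏ i ∈ F.toFinite.toFinset, A.coord i

theorem coord_dvd_flatCoordProd (A : Arrangement k I V) (F : Set I) (i : F) :
    A.coord i ∣ A.flatCoordProd F :=
  Finset.dvd_prod_of_mem _ (by simp)

/-- Multiplied by the coordinates indexed by `F`, the functionals in the span of `F` become regular
on the reciprocal plane. -/
theorem exists_flatSpan_linearMap_coordRing (A : Arrangement k I V) (F : Set I) :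
    ∃ μ : A.flatSpan F →ₗ[k] A.coordRing,
      ∀ i : F, A.coord i * μ (A.flatFunctional F i) = A.flatCoordProd F := by
  let ν : A.flatSpan F →ₗ[k] A.complementRing :=
    LinearMap.mulLeft k (A.toComplementRing (A.flatCoordProd F)) ∘ₗ A.linearFunction ∘ₗ
      (A.flatSpan F).subtype
  have hν (l) : ν l = A.toComplementRing (A.flatCoordProd F) * A.linearFunction l := rfl
  -- On a generator `a i` the factor `coord i` of the product cancels against `a i` and leaves the
  -- cofactor `c`, which is regular. Linearity gives the rest of the span.
  have hrange (l) : ν l ∈ LinearMap.range A.toComplementRing.toLinearMap := by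
    obtain ⟨l, hl⟩ := l
    rw [hν]
    induction hl using Submodule.span_induction with
    | mem x hx =>
      obtain ⟨i, hi, rfl⟩ := hx
      obtain ⟨c, hc⟩ := A.coord_dvd_flatCoordProd F ⟨i, hi⟩
      refine ⟨c, ?_⟩
      change A.toComplementRing c = _
      rw [hc, map_mul, mul_right_comm, mul_comm _ (A.linearFunction _)]
      rw [linearFunction_mul_coord, one_mul]
    | zero => simp
    | add x y _ _ hx hy =>
      simp only [map_add, mul_add] at *
      exact add_mem hx hy
    | smul c x _ hx =>
      simp only [map_smul, mul_smul_comm] at *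
      exact Submodule.smul_mem _ _ hx
  let e := LinearEquiv.ofInjective A.toComplementRing.toLinearMap A.toComplementRing_injective
  refine ⟨e.symm.toLinearMap ∘ₗ ν.codRestrict _ hrange, fun i => ?_⟩
  apply A.toComplementRing_injective
  have h1 : A.toComplementRing (e.symm (ν.codRestrict _ hrange (A.flatFunctional F i))) =
      ν (A.flatFunctional F i) := congrArg Subtype.val (e.apply_symm_apply _)
  rw [map_mul]
  refine (congrArg _ h1).trans ?_
  rw [hν, mul_left_comm, mul_comm (A.toComplementRing (A.coord _))]
  change _ * (A.linearFunction (A.a i) * _) = _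
  rw [linearFunction_mul_coord, mul_one]

/-- Where the coordinates indexed by `F` are invertible, the functionals in the span of `F` are
regular. -/
theorem exists_flatSpan_linearMap (A : Arrangement k I V) (F : Set I) {B : Type*} [CommRing B]
    [Algebra k B] (f : A.coordRing →ₐ[k] B) (hf : ∀ i : F, IsUnit (f (A.coord i))) :
    ∃ l : A.flatSpan F →ₗ[k] B, ∀ i : F, l (A.flatFunctional F i) * f (A.coord i) = 1 := by
  obtain ⟨μ, hμ⟩ := A.exists_flatSpan_linearMap_coordRing F
  have hu : IsUnit (f (A.flatCoordProd F)) := by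
    rw [flatCoordProd, map_prod, IsUnit.prod_iff]
    exact fun i hi => hf ⟨i, by simpa using hi⟩
  obtain ⟨c, hc⟩ := hu.exists_right_inv
  refine ⟨LinearMap.mulLeft k c ∘ₗ f.toLinearMap ∘ₗ μ, fun i => ?_⟩
  change c * f (μ _) * f _ = 1
  rw [mul_assoc, ← map_mul, mul_comm (μ _), hμ, mul_comm, hc]

/-- The only choice in the construction: the chart is determined by `p`. -/
theorem exists_flatSpan_projection (A : Arrangement k I V) (F : Set I) :
    ∃ p : Module.Dual k V →ₗ[k] A.flatSpan F, ∀ l : A.flatSpan F, p l = l := by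
  obtain ⟨p, hp⟩ := LinearMap.exists_leftInverse_of_injective (K := k)
    (V := A.flatSpan F) (V' := Module.Dual k V) (A.flatSpan F).subtype (Submodule.ker_subtype _)
  exact ⟨p, LinearMap.congr_fun hp⟩

theorem flatFunctional_eq_projection (A : Arrangement k I V) (F : Set I)
    {p : Module.Dual k V →ₗ[k] A.flatSpan F} (hp : ∀ l : A.flatSpan F, p l = l) (i : F) :
    p (A.a i) = A.flatFunctional F i :=
  hp (A.flatFunctional F i)

/-- A projection of the dual space onto the span of `F` yields a complementary section of the
restriction of functionals to `V^F`. -/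
theorem exists_dualRestrict_section (A : Arrangement k I V) (F : Set I)
    {p : Module.Dual k V →ₗ[k] A.flatSpan F} (hp : ∀ l : A.flatSpan F, p l = l) :
    ∃ s : Module.Dual k (A.flatSpace F) →ₗ[k] Module.Dual k V,
      ∀ m, s ((A.flatSpace F).dualRestrict m) = m - p m := by
  obtain ⟨r, hr⟩ := (A.flatSpace F).dualRestrict.exists_rightInverse_of_surjective
    (LinearMap.range_eq_top.2 Subspace.dualRestrict_surjective)
  -- A section `r` recovers `m` from its restriction only up to the annihilator of `V^F`, which is
  -- the span of `F`. Since `p` fixes that span, `id - p` removes the ambiguity.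
  refine ⟨(LinearMap.id - (A.flatSpan F).subtype ∘ₗ p) ∘ₗ r, fun m => ?_⟩
  have hmem : r ((A.flatSpace F).dualRestrict m) - m ∈ A.flatSpan F := by
    have h1 : r ((A.flatSpace F).dualRestrict m) - m ∈
        LinearMap.ker (A.flatSpace F).dualRestrict := by
      rw [LinearMap.mem_ker, map_sub, sub_eq_zero]
      exact LinearMap.congr_fun hr _
    rwa [Submodule.dualRestrict_ker_eq_dualAnnihilator,
      show (A.flatSpace F).dualAnnihilator = A.flatSpan F from
        Subspace.dualCoannihilator_dualAnnihilator_eq] at h1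
  have h2 := congrArg Subtype.val (hp ⟨_, hmem⟩)
  simp only [map_sub, Submodule.coe_sub] at h2
  change r _ - (p (r _) : Module.Dual k V) = _
  rw [sub_eq_sub_iff_sub_eq_sub, h2]

/-- The homomorphism `evalZero` is `k`-linear. -/
def evalZeroₐ (A : Arrangement k I V) : A.coordRing →ₐ[k] k :=
  { A.evalZero with commutes' := fun r => MvPolynomial.constantCoeff_C (σ := I) r }

theorem evalZeroₐ_coord (A : Arrangement k I V) (i : I) : A.evalZeroₐ (A.coord i) = 0 :=
  MvPolynomial.constantCoeff_X (R := k) i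

/-! ### The inverse map, from the product to the reciprocal plane -/

section Degeneration

variable {S : Type*} [CommRing S] [Algebra k S]

/-- The function `1 + c_j w_j` on the product of `X_{A^F}` and a scheme with functions `c_j`. -/
def shift (A : Arrangement k I V) (F : Set I) (hF : A.matroid.IsFlat F) (c : (Fᶜ : Set I) → S)
    (j : (Fᶜ : Set I)) : (A.restriction F hF).coordRing ⊗[k] S :=
  1 + (A.restriction F hF).coord j ⊗ₜ c j

/-- The product of the functions `1 + c_j w_j`. -/
def shiftProd (A : Arrangement k I V) (F : Set I) (hF : A.matroid.IsFlat F)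
    (c : (Fᶜ : Set I) → S) : (A.restriction F hF).coordRing ⊗[k] S :=
  ∏ j ∈ Set.finite_univ.toFinset, A.shift F hF c j

theorem isUnit_map_shiftProd_iff (A : Arrangement k I V) (F : Set I) (hF : A.matroid.IsFlat F)
    (c : (Fᶜ : Set I) → S) {B : Type*} [CommRing B] [Algebra k B]
    (f : (A.restriction F hF).coordRing ⊗[k] S →ₐ[k] B) :
    IsUnit (f (A.shiftProd F hF c)) ↔ ∀ j, IsUnit (f (A.shift F hF c j)) := by
  simp [shiftProd, map_prod, IsUnit.prod_iff]

/-- The map `(w, s) ↦ u` from an open part of the product of `X_{A^F}` and a scheme with a morphism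
to the complement of the functionals in `F`, with `u_j = w_j / (1 + c_j w_j)` for `j ∉ F`. -/
theorem exists_coordRing_algHom_away (A : Arrangement k I V) (F : Set I)
    (hF : A.matroid.IsFlat F) {p : Module.Dual k V →ₗ[k] A.flatSpan F}
    (hp : ∀ l : A.flatSpan F, p l = l) (l : A.flatSpan F →ₗ[k] S) (s : F → S)
    (hs : ∀ i, l (A.flatFunctional F i) * s i = 1) :
    ∃ f : A.coordRing →ₐ[k] Localization.Away (A.shiftProd F hF fun j => l (p (A.a j))),
      (∀ i : F, f (A.coord i) = algebraMap _ _ ((1 : (A.restriction F hF).coordRing) ⊗ₜ[k] s i)) ∧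
      ∀ j : (Fᶜ : Set I), f (A.coord j) *
        algebraMap _ _ (A.shift F hF (fun j => l (p (A.a j))) j) =
          algebraMap _ _ ((A.restriction F hF).coord j ⊗ₜ[k] (1 : S)) := by
  classical
  let R := A.restriction F hF
  obtain ⟨C, _, _, toC, lin, hinj, hlin⟩ := R.exists_generic_point
  set h := A.shiftProd F hF fun j => l (p (A.a j))
  let t : R.coordRing ⊗[k] S →ₐ[k] C ⊗[k] S :=
    Algebra.TensorProduct.map toC (AlgHom.id k S)
  -- Everything is flat over the field `k`.
  have ht : Function.Injective t :=
    Module.Flat.rTensor_preserves_injective_linearMap (M := S) toC.toLinearMap hinj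
  have hunit (j : (Fᶜ : Set I)) : IsUnit (algebraMap _ (Localization.Away h)
      (A.shift F hF (fun j => l (p (A.a j))) j)) :=
    (A.isUnit_map_shiftProd_iff F hF _ (IsScalarTower.toAlgHom k
        ((A.restriction F hF).coordRing ⊗[k] S) (Localization.Away h))).1
      (IsLocalization.Away.algebraMap_isUnit h) j
  -- The point of `V` assembled from the generic point of `V^F` and the point `l` along the
  -- splitting. It sends `a i` to `l (a i)` for `i ∈ F`, and `a j` to `1 / w_j + c_j = (1 + c_j w_j)
  -- / w_j` for `j ∉ F`.
  let m : Module.Dual k V →ₗ[k] C ⊗[k] S :=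
    Algebra.TensorProduct.includeLeft.toLinearMap ∘ₗ lin ∘ₗ
        (A.flatSpace F).dualRestrict +
      Algebra.TensorProduct.includeRight.toLinearMap ∘ₗ l ∘ₗ p
  have hm (x) : m x = lin ((A.flatSpace F).dualRestrict x) ⊗ₜ 1 +
    1 ⊗ₜ l (p x) := rfl
  have hm₁ (i : F) : m (A.a i) * t (1 ⊗ₜ[k] s i) = 1 := by
    have h0 : (A.flatSpace F).dualRestrict (A.a i) = 0 := by
      ext w
      exact (Submodule.mem_dualCoannihilator _).1 w.2 _
        (Submodule.subset_span (Set.mem_image_of_mem _ i.2))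
    rw [hm, h0, map_zero, TensorProduct.zero_tmul, zero_add,
      A.flatFunctional_eq_projection F hp, Algebra.TensorProduct.map_tmul, map_one,
      Algebra.TensorProduct.tmul_mul_tmul, AlgHom.id_apply, hs, one_mul,
      Algebra.TensorProduct.one_def]
  have hm₂ (j : (Fᶜ : Set I)) : m (A.a j) * t (R.coord j ⊗ₜ[k] (1 : S)) =
      t (A.shift F hF (fun j => l (p (A.a j))) j) := by
    have h2 : lin ((A.flatSpace F).dualRestrict (A.a j)) *
      toC (R.coord j) = 1 := hlin j
    rw [hm, shift, map_add, map_one, Algebra.TensorProduct.map_tmul,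
      Algebra.TensorProduct.map_tmul, add_mul, Algebra.TensorProduct.tmul_mul_tmul,
      Algebra.TensorProduct.tmul_mul_tmul, h2, one_mul, map_one, one_mul, mul_one,
      AlgHom.id_apply, Algebra.TensorProduct.one_def]
  obtain ⟨f, hf⟩ := A.exists_coordRing_algHom_fractions t ht m
    (fun i => if hi : i ∈ F then 1 ⊗ₜ[k] s ⟨i, hi⟩ else R.coord ⟨i, hi⟩ ⊗ₜ[k] (1 : S))
    (fun i => if hi : i ∈ F then 1 else A.shift F hF (fun j => l (p (A.a j))) ⟨i, hi⟩)
    (fun i => by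
      by_cases hi : i ∈ F
      · simpa only [dif_pos hi, map_one] using hm₁ ⟨i, hi⟩
      · simpa only [dif_neg hi] using hm₂ ⟨i, hi⟩) h
    (fun i => by
      by_cases hi : i ∈ F
      · simp only [dif_pos hi, map_one, isUnit_one]
      · simpa only [dif_neg hi] using hunit ⟨i, hi⟩)
  refine ⟨f, fun i => ?_, fun j => ?_⟩
  · simpa only [dif_pos i.2, map_one, mul_one] using hf i
  · have hj : (j : I) ∉ F := j.2
    simpa only [dif_neg hj] using hf j

/-- The retraction onto the stratum: the coordinates that are not indexed by `F` are set to zero. -/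
theorem exists_coordRing_algHom_retraction (A : Arrangement k I V) (F : Set I)
    (hF : A.matroid.IsFlat F) (l : A.flatSpan F →ₗ[k] S) (s : F → S)
    (hs : ∀ i, l (A.flatFunctional F i) * s i = 1) :
    ∃ f : A.coordRing →ₐ[k] S, (∀ i : F, f (A.coord i) = s i) ∧
      ∀ j : (Fᶜ : Set I), f (A.coord j) = 0 := by
  obtain ⟨p, hp⟩ := A.exists_flatSpan_projection F
  obtain ⟨f, hf₁, hf₂⟩ := A.exists_coordRing_algHom_away F hF hp l s hs
  -- Specialization to `w = 0`. There every `1 + c_j w_j` equals `1`, so the map of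
  -- `exists_coordRing_algHom_away` is defined, and `u_j` becomes `0`.
  let e : (A.restriction F hF).coordRing ⊗[k] S →ₐ[k] S :=
    Algebra.TensorProduct.lift ((Algebra.ofId k S).comp (A.restriction F hF).evalZeroₐ)
      (AlgHom.id k S) fun _ _ => Commute.all _ _
  have he (j) : e (A.shift F hF (fun j => l (p (A.a j))) j) = 1 := by
    simp [e, shift, evalZeroₐ_coord]
  obtain ⟨e', he'⟩ := Localization.exists_awayLift_algHom e
    (A.shiftProd F hF fun j => l (p (A.a j)))
    ((A.isUnit_map_shiftProd_iff F hF _ e).2 fun j => by rw [he]; exact isUnit_one)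
  refine ⟨e'.comp f, fun i => ?_, fun j => ?_⟩
  · rw [AlgHom.comp_apply, hf₁, he']
    simp [e]
  · have h := congrArg e' (hf₂ j)
    rw [map_mul, he', he', he, mul_one] at h
    rw [AlgHom.comp_apply, h]
    simp [e, evalZeroₐ_coord]

end Degeneration

/-! ### Functions on the stratum -/

instance (A : Arrangement k I V) (F : Set I) : Algebra k (A.closedStratumRing F) :=
  Ideal.Quotient.algebra k

/-- The restriction of functions from the reciprocal plane to the stratum. -/
def toStratumRing (A : Arrangement k I V) (F : Set I) : A.coordRing →ₐ[k] A.stratumRing F :=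
  (IsScalarTower.toAlgHom k (A.closedStratumRing F) (A.stratumRing F)).comp
    (Ideal.Quotient.mkₐ k (A.stratumIdeal F))

theorem isUnit_toStratumRing_coord (A : Arrangement k I V) (F : Set I) (i : F) :
    IsUnit (A.toStratumRing F (A.coord i)) :=
  IsLocalization.map_units (A.stratumRing F)
    (⟨_, Submonoid.subset_closure ⟨i, rfl⟩⟩ : Submonoid.closure
      (Set.range fun i : F => A.toClosedStratumRing F (A.coord i)))

theorem toStratumRing_coord_eq_zero (A : Arrangement k I V) (F : Set I) (j : (Fᶜ : Set I)) :
    A.toStratumRing F (A.coord j) = 0 := by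
  have : A.toClosedStratumRing F (A.coord j) = 0 := Ideal.Quotient.eq_zero_iff_mem.2
    (Ideal.le_radical (Ideal.subset_span (Set.mem_image_of_mem _ j.2)))
  change algebraMap _ _ (A.toClosedStratumRing F (A.coord j)) = 0
  rw [this, map_zero]

/-- The coordinates outside `F` vanish on the stratum, and passing to a quotient or a localization
creates no further freedom. -/
theorem stratumRing_algHom_ext (A : Arrangement k I V) (F : Set I) {B : Type*} [CommRing B]
    [Algebra k B] {f g : A.stratumRing F →ₐ[k] B}
    (h : ∀ i : F, f (A.toStratumRing F (A.coord i)) = g (A.toStratumRing F (A.coord i))) :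
    f = g := by
  have h1 : f.comp (A.toStratumRing F) = g.comp (A.toStratumRing F) := by
    refine A.coordRing_algHom_ext fun i => ?_
    by_cases hi : i ∈ F
    · exact h ⟨i, hi⟩
    · have := A.toStratumRing_coord_eq_zero F ⟨i, hi⟩
      simp only [AlgHom.comp_apply]
      rw [this, map_zero, map_zero]
  refine IsLocalization.algHom_ext (Submonoid.closure
    (Set.range fun i : F => A.toClosedStratumRing F (A.coord i))) ?_
  exact Ideal.Quotient.algHom_ext _ h1

/-- The stratum is the complement of the functionals indexed by `F`. -/
theorem exists_stratumRing_algHom (A : Arrangement k I V) (F : Set I) (hF : A.matroid.IsFlat F)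
    {S : Type*} [CommRing S] [Algebra k S] [_root_.IsReduced S] (l : A.flatSpan F →ₗ[k] S)
    (s : F → S) (hs : ∀ i, l (A.flatFunctional F i) * s i = 1) :
    ∃ f : A.stratumRing F →ₐ[k] S, ∀ i : F, f (A.toStratumRing F (A.coord i)) = s i := by
  obtain ⟨f, hf₁, hf₂⟩ := A.exists_coordRing_algHom_retraction F hF l s hs
  -- The stratum is defined by a radical ideal, whence the need for `S` to be reduced.
  have hle : A.stratumIdeal F ≤ RingHom.ker f := by
    rintro x ⟨n, hn⟩
    have hspan : Ideal.span (A.coord '' Fᶜ) ≤ RingHom.ker f := by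
      refine Ideal.span_le.2 ?_
      rintro _ ⟨j, hj, rfl⟩
      exact hf₂ ⟨j, hj⟩
    have h1 : f (x ^ n) = 0 := hspan hn
    rw [map_pow] at h1
    exact eq_zero_of_pow_eq_zero h1
  let f' : A.closedStratumRing F →ₐ[k] S := Ideal.Quotient.liftₐ (A.stratumIdeal F) f hle
  have hf' (x) : f' (A.toClosedStratumRing F x) = f x := rfl
  have hunit : ∀ y : Submonoid.closure
      (Set.range fun i : F => A.toClosedStratumRing F (A.coord i)), IsUnit (f' y) := by
    have : Submonoid.closure (Set.range fun i : F => A.toClosedStratumRing F (A.coord i)) ≤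
        (IsUnit.submonoid S).comap f' := by
      refine Submonoid.closure_le.2 ?_
      rintro _ ⟨i, rfl⟩
      change IsUnit (f' _)
      rw [hf', hf₁]
      exact IsUnit.of_mul_eq_one_right _ (hs i)
    exact fun y => this y.2
  refine ⟨IsLocalization.liftAlgHom (M := Submonoid.closure
      (Set.range fun i : F => A.toClosedStratumRing F (A.coord i))) hunit, fun i => ?_⟩
  exact (IsLocalization.lift_eq (g := f'.toRingHom) hunit _).trans (hf₁ i)

/-! ### The slice map on its domain -/

/-- The domain of definition of the map to the slice: a function the invertibility of which, where
the coordinates indexed by `F` are invertible, amounts to that of all functions `1 - c_j u_j`. -/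
theorem exists_sliceDomain (A : Arrangement k I V) (F : Set I)
    (p : Module.Dual k V →ₗ[k] A.flatSpan F) :
    ∃ g : A.coordRing, (∀ i : F, A.coord i ∣ g) ∧
      ∀ {B : Type u} [CommRing B] [Algebra k B] (f : A.coordRing →ₐ[k] B)
        (l : A.flatSpan F →ₗ[k] B), (∀ i : F, l (A.flatFunctional F i) * f (A.coord i) = 1) →
        (IsUnit (f g) ↔
          ∀ j : (Fᶜ : Set I), IsUnit (1 - l (p (A.a j)) * f (A.coord j))) := by
  obtain ⟨μ, hμ⟩ := A.exists_flatSpan_linearMap_coordRing F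
  -- With `P = flatCoordProd`, one has `c_j = μ (p (a j)) / P`, so each factor is `P (1 - c_j u_j)`
  -- with the denominator cleared. The leading `P` makes the `u_i` divide the result even when `F`
  -- is everything.
  refine ⟨A.flatCoordProd F * ∏ j ∈ (Set.toFinite (Fᶜ : Set I)).toFinset,
    (A.flatCoordProd F - μ (p (A.a j)) * A.coord j),
    fun i => (A.coord_dvd_flatCoordProd F i).mul_right _, fun {B} _ _ f l hl => ?_⟩
  have hu : IsUnit (f (A.flatCoordProd F)) := by
    rw [flatCoordProd, map_prod, IsUnit.prod_iff]
    exact fun i hi => IsUnit.of_mul_eq_one_right _ (hl ⟨i, by simpa using hi⟩)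
  have hμl : f.toLinearMap ∘ₗ μ = LinearMap.mulLeft k (f (A.flatCoordProd F)) ∘ₗ l := by
    refine A.flatSpan_linearMap_ext F fun i => ?_
    change f (μ _) = f _ * l _
    rw [← hμ i, map_mul, mul_right_comm, mul_comm (f (A.coord i)), hl, one_mul]
  have hfac (j : I) : f (A.flatCoordProd F - μ (p (A.a j)) * A.coord j) =
      f (A.flatCoordProd F) * (1 - l (p (A.a j)) * f (A.coord j)) := by
    have : f (μ (p (A.a j))) = _ := LinearMap.congr_fun hμl (p (A.a j))
    rw [map_sub, map_mul, this, LinearMap.comp_apply, LinearMap.mulLeft_apply]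
    ring
  rw [map_mul, IsUnit.mul_iff, map_prod, IsUnit.prod_iff]
  simp only [hfac, IsUnit.mul_iff, hu, true_and]
  simp

/-- The map from the domain of definition to the slice `X_{A^F}`, with coordinates
`u_j / (1 - c_j u_j)`. -/
theorem exists_restriction_algHom_of_injective (A : Arrangement k I V) (F : Set I)
    (hF : A.matroid.IsFlat F) {p : Module.Dual k V →ₗ[k] A.flatSpan F}
    (hp : ∀ l : A.flatSpan F, p l = l) {B Q : Type*} [CommRing B] [CommRing Q] [Algebra k B]
    [Algebra k Q] (f : A.coordRing →ₐ[k] B) (t : B →ₐ[k] Q) (ht : Function.Injective t)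
    (m : Module.Dual k V →ₗ[k] Q) (hm : ∀ i, m (A.a i) * t (f (A.coord i)) = 1)
    (l : A.flatSpan F →ₗ[k] B) (hl : ∀ i : F, l (A.flatFunctional F i) * f (A.coord i) = 1)
    (hg : ∀ j : (Fᶜ : Set I), IsUnit (1 - l (p (A.a j)) * f (A.coord j))) :
    ∃ φ : (A.restriction F hF).coordRing →ₐ[k] B, ∀ j : (Fᶜ : Set I),
      φ ((A.restriction F hF).coord j) * (1 - l (p (A.a j)) * f (A.coord j)) =
        f (A.coord j) := by
  obtain ⟨s, hs⟩ := A.exists_dualRestrict_section F hp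
  choose c hc using fun j => (hg j).exists_right_inv
  -- On the generators `a i`, `i ∈ F`, both sides are the inverse of `u_i`.
  have hml : m ∘ₗ (A.flatSpan F).subtype = t.toLinearMap ∘ₗ l := by
    refine A.flatSpan_linearMap_ext F fun i => ?_
    refine (IsUnit.of_mul_eq_one_right _ (hm i)).mul_right_cancel ((hm i).trans ?_)
    change 1 = t (l _) * _
    rw [← map_mul, hl, map_one]
  -- The value of `m ∘ s` at the restriction of `a j` is `1 / u_j - c_j = (1 - c_j u_j) / u_j`.
  have hms (j : (Fᶜ : Set I)) :
      (m ∘ₗ s) ((A.restriction F hF).a j) * t (f (A.coord j) * c j) = 1 := by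
    have h1 : m (s ((A.restriction F hF).a j)) = m (A.a j) - t (l (p (A.a j))) := by
      refine (congrArg m (hs (A.a j))).trans ?_
      rw [map_sub]
      exact congrArg _ (LinearMap.congr_fun hml (p (A.a j)))
    rw [LinearMap.comp_apply, h1, map_mul, ← mul_assoc, sub_mul, hm, ← map_mul t,
      ← map_one t, ← map_sub, ← map_mul, hc]
  obtain ⟨φ, hφ⟩ := (A.restriction F hF).exists_coordRing_algHom t ht (m ∘ₗ s) _ hms
  refine ⟨φ, fun j => ?_⟩
  rw [hφ, mul_assoc, mul_comm (c j), hc, mul_one]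

/-- The larger ring needed in `exists_restriction_algHom_of_injective` comes from the generic point
of `X_A`, localized at `g`. -/
theorem exists_restriction_algHom (A : Arrangement k I V) (F : Set I) (hF : A.matroid.IsFlat F)
    {p : Module.Dual k V →ₗ[k] A.flatSpan F} (hp : ∀ l : A.flatSpan F, p l = l) (g : A.coordRing)
    (l : A.flatSpan F →ₗ[k] Localization.Away g)
    (hl : ∀ i : F, l (A.flatFunctional F i) * algebraMap _ _ (A.coord i) = 1)
    (hg : ∀ j : (Fᶜ : Set I), IsUnit (1 - l (p (A.a j)) * algebraMap _ _ (A.coord j))) :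
    ∃ f : (A.restriction F hF).coordRing →ₐ[k] Localization.Away g, ∀ j : (Fᶜ : Set I),
      f ((A.restriction F hF).coord j) * (1 - l (p (A.a j)) * algebraMap _ _ (A.coord j)) =
        algebraMap _ _ (A.coord j) := by
  obtain ⟨C, _, _, t, m, ht, hm⟩ := A.exists_generic_point
  refine A.exists_restriction_algHom_of_injective F hF hp
    (IsScalarTower.toAlgHom k A.coordRing (Localization.Away g)) (Localization.awayMapₐ t g)
    (Localization.awayMapₐ_injective t g ht)
    ((IsScalarTower.toAlgHom k C (Localization.Away (t g))).toLinearMap ∘ₗ m) (fun i => ?_) l hl hg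
  change algebraMap C (Localization.Away (t g)) _ *
    Localization.awayMapₐ t g (algebraMap _ _ (A.coord i)) = 1
  rw [Localization.awayMapₐ_algebraMap, ← map_mul, hm, map_one]

/-! ### The two maps are inverse to each other -/

/-- The map `u ↦ (u_j / (1 - c_j u_j), u_i)` is an open immersion, the inverse of which is given by
`u_j = w_j / (1 + c_j w_j)`. -/
theorem isOpenImmersion_slice (A : Arrangement k I V) (F : Set I) (hF : A.matroid.IsFlat F)
    {p : Module.Dual k V →ₗ[k] A.flatSpan F} (hp : ∀ l : A.flatSpan F, p l = l) (g : A.coordRing)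
    (hg : ∀ {B : Type u} [CommRing B] [Algebra k B] (f : A.coordRing →ₐ[k] B)
        (l : A.flatSpan F →ₗ[k] B), (∀ i : F, l (A.flatFunctional F i) * f (A.coord i) = 1) →
        (∀ j : (Fᶜ : Set I), IsUnit (1 - l (p (A.a j)) * f (A.coord j))) → IsUnit (f g))
    (l : A.flatSpan F →ₗ[k] Localization.Away g)
    (hl : ∀ i : F, l (A.flatFunctional F i) * algebraMap _ _ (A.coord i) = 1)
    (φ₁ : (A.restriction F hF).coordRing →ₐ[k] Localization.Away g)
    (hφ₁ : ∀ j : (Fᶜ : Set I), φ₁ ((A.restriction F hF).coord j) *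
      (1 - l (p (A.a j)) * algebraMap _ _ (A.coord j)) = algebraMap _ _ (A.coord j))
    {T : Type u} [CommRing T] [Algebra k T] (π : A.coordRing →ₐ[k] T)
    (hπ : ∀ i : F, IsUnit (π (A.coord i)))
    (hT : ∀ {B : Type u} [CommRing B] [Algebra k B] {f g : T →ₐ[k] B},
      (∀ i : F, f (π (A.coord i)) = g (π (A.coord i))) → f = g)
    (φ₂ : T →ₐ[k] Localization.Away g)
    (hφ₂ : ∀ i : F, φ₂ (π (A.coord i)) = algebraMap _ _ (A.coord i)) :
    IsOpenImmersion (Spec.map (CommRingCat.ofHom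
      (Algebra.TensorProduct.lift φ₁ φ₂ fun _ _ => Commute.all _ _).toRingHom)) := by
  obtain ⟨lT, hlT⟩ := A.exists_flatSpan_linearMap F π hπ
  -- The functions `c_j` on the chart are thus pulled back from `T`.
  have hl₂ (m : A.flatSpan F) : φ₂ (lT m) = l m := by
    refine LinearMap.congr_fun (A.flatSpan_linearMap_ext F (f := φ₂.toLinearMap ∘ₗ lT) (g := l)
      fun i => ?_) m
    refine (IsUnit.of_mul_eq_one_right _ (hl i)).mul_right_cancel (Eq.trans ?_ (hl i).symm)
    change φ₂ (lT _) * _ = 1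
    rw [← hφ₂, ← map_mul, hlT, map_one]
  obtain ⟨c, hc⟩ : ∃ c : (Fᶜ : Set I) → T, c = fun j : (Fᶜ : Set I) => lT (p (A.a j)) :=
    ⟨_, rfl⟩
  let φ : (A.restriction F hF).coordRing ⊗[k] T →ₐ[k] Localization.Away g :=
    Algebra.TensorProduct.lift φ₁ φ₂ fun _ _ => Commute.all _ _
  have hφl (r) : φ (r ⊗ₜ 1) = φ₁ r := by simp [φ]
  have hφr (t) : φ (1 ⊗ₜ t) = φ₂ t := by simp [φ]
  -- The identity `(1 + c_j w_j)(1 - c_j u_j) = 1`, from `w_j (1 - c_j u_j) = u_j`. It places the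
  -- image of the chart where all `1 + c_j w_j` are invertible.
  have hφs (j : (Fᶜ : Set I)) : φ (A.shift F hF c j) *
      (1 - l (p (A.a j)) * algebraMap _ _ (A.coord j)) = 1 := by
    have h1 : φ (A.shift F hF c j) = 1 + φ₁ ((A.restriction F hF).coord j) * l (p (A.a j)) := by
      simp [φ, shift, hc, hl₂]
    rw [h1]
    linear_combination l (p (A.a j)) * hφ₁ j
  obtain ⟨χ, hχ⟩ := Localization.exists_awayLift_algHom φ (A.shiftProd F hF c)
    ((A.isUnit_map_shiftProd_iff F hF c φ).2 fun j => IsUnit.of_mul_eq_one _ (hφs j))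
  have hex := A.exists_coordRing_algHom_away F hF hp lT (fun i => π (A.coord i)) hlT
  rw [← hc] at hex
  obtain ⟨ψ₀, hψ₁, hψ₂⟩ := hex
  generalize A.shiftProd F hF c = h at χ hχ ψ₀ hψ₁ hψ₂
  let ι : (A.restriction F hF).coordRing ⊗[k] T →ₐ[k] Localization.Away h :=
    IsScalarTower.toAlgHom k ((A.restriction F hF).coordRing ⊗[k] T)
      (Localization.Away h)
  replace hψ₁ (i : F) : ψ₀ (A.coord i) = ι (1 ⊗ₜ π (A.coord i)) := hψ₁ i
  replace hψ₂ (j : (Fᶜ : Set I)) : ψ₀ (A.coord j) * ι (A.shift F hF c j) =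
    ι ((A.restriction F hF).coord j ⊗ₜ 1) := hψ₂ j
  replace hχ (x) : χ (ι x) = φ x := hχ x
  let lP : A.flatSpan F →ₗ[k] Localization.Away h :=
    ι.toLinearMap ∘ₗ Algebra.TensorProduct.includeRight.toLinearMap ∘ₗ lT
  have hlP' (m) : lP m = ι (1 ⊗ₜ lT m) := rfl
  have hlP (i : F) : lP (A.flatFunctional F i) * ψ₀ (A.coord i) = 1 := by
    rw [hlP', hψ₁]
    change (ι.comp Algebra.TensorProduct.includeRight) _ *
      (ι.comp Algebra.TensorProduct.includeRight) _ = 1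
    rw [← map_mul, hlT, map_one]
  -- The same identity, now from `u_j (1 + c_j w_j) = w_j`. By `hg` it makes `g` invertible.
  have hψs (j : (Fᶜ : Set I)) : (1 - lP (p (A.a j)) * ψ₀ (A.coord j)) *
      ι (A.shift F hF c j) = 1 := by
    have h1 : ι (A.shift F hF c j) =
        1 + ι ((A.restriction F hF).coord j ⊗ₜ 1) * lP (p (A.a j)) := by
      rw [hlP', shift, map_add, map_one, hc]
      exact congrArg _ (Algebra.TensorProduct.map_tmul_eq_mul ι _ _)
    linear_combination h1 - lP (p (A.a j)) * hψ₂ j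
  obtain ⟨ψ, hψ⟩ := Localization.exists_awayLift_algHom ψ₀ g
    (hg ψ₀ lP hlP fun j => IsUnit.of_mul_eq_one _ (hψs j))
  have hψl (m : A.flatSpan F) : ψ (l m) = lP m := by
    refine LinearMap.congr_fun (A.flatSpan_linearMap_ext F (f := ψ.toLinearMap ∘ₗ l) (g := lP)
      fun i => ?_) m
    refine (IsUnit.of_mul_eq_one_right _ (hlP i)).mul_right_cancel (Eq.trans ?_ (hlP i).symm)
    change ψ (l _) * _ = 1
    rw [← hψ, ← map_mul, hl, map_one]
  have e₁ : ψ.comp χ = AlgHom.id k _ := by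
    refine IsLocalization.algHom_ext (Submonoid.powers h) ?_
    refine Algebra.TensorProduct.ext ?_ ?_
    · refine (A.restriction F hF).coordRing_algHom_ext fun j => ?_
      change ψ (χ (ι _)) = ι _
      have h1 := congrArg ψ (hφ₁ j)
      rw [map_mul, map_sub, map_one, map_mul, hψl, hψ] at h1
      rw [hχ]
      change ψ (φ (_ ⊗ₜ 1)) = ι (_ ⊗ₜ 1)
      rw [hφl, ← hψ₂ j, ← h1, mul_assoc, hψs, mul_one]
    · refine hT fun i => ?_
      change ψ (χ (ι _)) = ι _
      rw [hχ]
      change ψ (φ (1 ⊗ₜ _)) = ι (1 ⊗ₜ _)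
      rw [hφr, hφ₂, hψ, hψ₁]
  have e₂ : χ.comp ψ = AlgHom.id k _ := by
    refine IsLocalization.algHom_ext (Submonoid.powers g) ?_
    refine A.coordRing_algHom_ext fun i => ?_
    change χ (ψ (algebraMap _ _ (A.coord i))) = algebraMap _ _ (A.coord i)
    rw [hψ]
    by_cases hi : i ∈ F
    · rw [hψ₁ ⟨i, hi⟩, hχ, hφr, hφ₂]
    · have h1 := congrArg χ (hψ₂ ⟨i, hi⟩)
      rw [map_mul, hχ, hχ, hφl] at h1
      rw [← hφ₁ ⟨i, hi⟩, ← h1, mul_assoc, hφs, mul_one]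
  exact isOpenImmersion_specMap_of_away φ.toRingHom h ψ.toRingHom χ.toRingHom
    (RingHom.ext hχ) (RingHom.ext fun x => DFunLike.congr_fun e₁ x)
    (RingHom.ext fun x => DFunLike.congr_fun e₂ x)

/-- The chart of the reciprocal plane along the stratum, in terms of rings. -/
theorem exists_slice_chart (A : Arrangement k I V) (F : Set I) (hF : A.matroid.IsFlat F) :
    ∃ (g : A.coordRing) (τ : Localization.Away g →ₐ[k] A.stratumRing F)
      (φ₁ : (A.restriction F hF).coordRing →ₐ[k] Localization.Away g)
      (φ₂ : A.stratumRing F →ₐ[k] Localization.Away g),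
      (∀ i : F, A.coord i ∣ g) ∧ (∀ x, τ (algebraMap _ _ x) = A.toStratumRing F x) ∧
      τ.comp φ₁ = (Algebra.ofId k _).comp (A.restriction F hF).evalZeroₐ ∧
      τ.comp φ₂ = AlgHom.id k _ ∧
      IsOpenImmersion (Spec.map (CommRingCat.ofHom
        (Algebra.TensorProduct.lift φ₁ φ₂ fun _ _ => Commute.all _ _).toRingHom)) := by
  obtain ⟨p, hp⟩ := A.exists_flatSpan_projection F
  obtain ⟨g, hdvd, hg⟩ := A.exists_sliceDomain F p
  let ι : A.coordRing →ₐ[k] Localization.Away g :=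
    IsScalarTower.toAlgHom k A.coordRing (Localization.Away g)
  have hunit : IsUnit (ι g) := IsLocalization.Away.algebraMap_isUnit g
  obtain ⟨l, hl⟩ := A.exists_flatSpan_linearMap F ι
    fun i => isUnit_of_dvd_unit (map_dvd ι (hdvd i)) hunit
  obtain ⟨φ₁, hφ₁⟩ := A.exists_restriction_algHom F hF hp g l hl ((hg ι l hl).1 hunit)
  have : _root_.IsReduced (Localization.Away g) :=
    isReduced_localizationPreserves (Submonoid.powers g) _ inferInstance
  obtain ⟨φ₂, hφ₂⟩ := A.exists_stratumRing_algHom F hF l (fun i => ι (A.coord i)) hl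
  obtain ⟨lT, hlT⟩ := A.exists_flatSpan_linearMap F (A.toStratumRing F)
    (A.isUnit_toStratumRing_coord F)
  obtain ⟨τ, hτ⟩ := Localization.exists_awayLift_algHom (A.toStratumRing F) g
    -- On the stratum `u_j = 0`, so `1 - c_j u_j = 1`: the whole stratum lies where `g` is
    -- invertible.
    ((hg _ lT hlT).2 fun j => by
      rw [A.toStratumRing_coord_eq_zero, mul_zero, sub_zero]
      exact isUnit_one)
  refine ⟨g, τ, φ₁, φ₂, hdvd, hτ, ?_, ?_, A.isOpenImmersion_slice F hF hp g
    (fun f l hl => (hg f l hl).2) l hl φ₁ hφ₁ (A.toStratumRing F)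
    (A.isUnit_toStratumRing_coord F) (A.stratumRing_algHom_ext F) φ₂ hφ₂⟩
  · refine (A.restriction F hF).coordRing_algHom_ext fun j => ?_
    have h1 := congrArg τ (hφ₁ j)
    rw [map_mul, map_sub, map_mul, hτ, A.toStratumRing_coord_eq_zero, mul_zero, sub_zero, map_one,
      mul_one] at h1
    rw [AlgHom.comp_apply, h1, AlgHom.comp_apply, evalZeroₐ_coord, map_zero]
  · refine A.stratumRing_algHom_ext F fun i => ?_
    rw [AlgHom.comp_apply, hφ₂, AlgHom.id_apply]
    exact hτ _

end

end Arrangement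

/-! ### From the ring-theoretic chart to schemes -/

theorem theorem3p3 {k : Type u} {I : Type u} {V : Type v} [Field k] [Finite I]
    [AddCommGroup V] [Module k V] [FiniteDimensional k V] (A : Arrangement k I V)
    (F : Set I) (hF : A.matroid.IsFlat F) (x : A.stratum F) :
    ∃ (W : A.recipPlane.Opens) (_ : W ≤ A.openStar F) (hx : A.stratumι F x ∈ W)
      (Φ : (W : Scheme.{u}) ⟶ A.sliceProduct F hF),
      -- `Φ` is a morphism over `k`
      Φ ≫ A.sliceProductToBase F hF = W.ι ≫ A.recipPlaneToBase ∧
      -- `Φ(x) = (0, x)`, as points with values in the residue field of `x`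
      (∃ xW : Spec ((A.stratum F).residueField x) ⟶ (W : Scheme.{u}),
        xW ≫ W.ι = (A.stratum F).fromSpecResidueField x ≫ A.stratumι F ∧
        xW ≫ Φ = (A.stratum F).fromSpecResidueField x ≫ A.zeroSection F hF) ∧
      EtaleAt Φ ⟨A.stratumι F x, hx⟩ := by
  obtain ⟨g, τ, φ₁, φ₂, hdvd, hτ, hτ₁, hτ₂, hφ⟩ := A.exists_slice_chart F hF
  let f : Spec (.of (Localization.Away g)) ⟶ A.recipPlane :=
    Spec.map (CommRingCat.ofHom (algebraMap A.coordRing (Localization.Away g)))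
  have : IsOpenImmersion f := IsOpenImmersion.of_isLocalization g
  let t : A.stratum F ⟶ Spec (.of (Localization.Away g)) :=
    Spec.map (CommRingCat.ofHom τ.toRingHom)
  have htf : t ≫ f = A.stratumι F := by
    rw [← Spec.map_comp, ← CommRingCat.ofHom_comp]
    exact congrArg (fun r => Spec.map (CommRingCat.ofHom r)) (RingHom.ext hτ)
  have hbase : A.stratumToBase F =
      Spec.map (CommRingCat.ofHom (algebraMap k (A.stratumRing F))) := by
    rw [Arrangement.stratumToBase, Arrangement.stratumι, Arrangement.recipPlaneToBase,
      ← Spec.map_comp, ← CommRingCat.ofHom_comp]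
    rfl
  have hf : f ≫ A.recipPlaneToBase =
      Spec.map (CommRingCat.ofHom (algebraMap k (Localization.Away g))) := by
    rw [Arrangement.recipPlaneToBase, ← Spec.map_comp, ← CommRingCat.ofHom_comp,
      ← IsScalarTower.algebraMap_eq]
  let f₁ : Spec (.of (Localization.Away g)) ⟶ (A.restriction F hF).recipPlane :=
    Spec.map (CommRingCat.ofHom φ₁.toRingHom)
  let f₂ : Spec (.of (Localization.Away g)) ⟶ A.stratum F :=
    Spec.map (CommRingCat.ofHom φ₂.toRingHom)
  have hf₁ : f₁ ≫ (A.restriction F hF).recipPlaneToBase =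
      Spec.map (CommRingCat.ofHom (algebraMap k (Localization.Away g))) := by
    rw [Arrangement.recipPlaneToBase, ← Spec.map_comp, ← CommRingCat.ofHom_comp]
    exact congrArg (fun r => Spec.map (CommRingCat.ofHom r)) φ₁.comp_algebraMap
  have hf₂ : f₂ ≫ A.stratumToBase F =
      Spec.map (CommRingCat.ofHom (algebraMap k (Localization.Away g))) := by
    rw [hbase, ← Spec.map_comp, ← CommRingCat.ofHom_comp]
    exact congrArg (fun r => Spec.map (CommRingCat.ofHom r)) φ₂.comp_algebraMap
  let Φ₀ : Spec (.of (Localization.Away g)) ⟶ A.sliceProduct F hF :=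
    pullback.lift f₁ f₂ (hf₁.trans hf₂.symm)
  have hΦ₀ : IsOpenImmersion Φ₀ :=
    isOpenImmersion_pullbackLift_specMap φ₁ φ₂ _ _ rfl hbase _ hφ
  -- The equality `Φ(x) = (0, x)` holds on the entire stratum at once; composing with the residue
  -- field point gives it at `x`.
  have ht : t ≫ Φ₀ = A.zeroSection F hF := by
    apply pullback.hom_ext
    · rw [Category.assoc, pullback.lift_fst, Arrangement.zeroSection, pullback.lift_fst, hbase,
        Arrangement.origin, ← Spec.map_comp, ← Spec.map_comp, ← CommRingCat.ofHom_comp,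
        ← CommRingCat.ofHom_comp]
      exact congrArg (fun r : _ →ₐ[k] _ => Spec.map (CommRingCat.ofHom r.toRingHom)) hτ₁
    · rw [Category.assoc, pullback.lift_snd, Arrangement.zeroSection, pullback.lift_snd,
        ← Spec.map_comp, ← CommRingCat.ofHom_comp]
      refine (congrArg (fun r : _ →ₐ[k] _ => Spec.map (CommRingCat.ofHom r.toRingHom)) hτ₂).trans ?_
      exact Spec.map_id _
  -- `W` is the locus where `g` is invertible. There `Φ` is an open immersion, so the étale
  -- neighbourhood is all of `W`.
  refine ⟨f.opensRange, ?_, ?_, f.isoOpensRange.inv ≫ Φ₀, ?_,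
    ⟨(A.stratum F).fromSpecResidueField x ≫ t ≫ f.isoOpensRange.hom, ?_, ?_⟩, ⊤, trivial, ?_⟩
  · rintro _ ⟨y, rfl⟩ i hi
    obtain ⟨b, hb⟩ := hdvd i
    have h1 : algebraMap A.coordRing (Localization.Away g) (A.coord i) ∈
      PrimeSpectrum.asIdeal y := hi
    refine (PrimeSpectrum.isPrime y).ne_top (Ideal.eq_top_of_isUnit_mem _
      (Ideal.mul_mem_right (algebraMap _ _ b) _ h1) ?_)
    rw [← map_mul, ← hb]
    exact IsLocalization.Away.algebraMap_isUnit g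
  · rw [← htf]
    exact ⟨t x, rfl⟩
  · rw [Category.assoc, Arrangement.sliceProductToBase, pullback.lift_snd_assoc, hf₂, ← hf,
      ← Category.assoc, Scheme.Hom.isoOpensRange_inv_comp]
  · rw [Category.assoc, Category.assoc, Scheme.Hom.isoOpensRange_hom_ι, htf]
  · rw [Category.assoc, Category.assoc, Iso.hom_inv_id_assoc, ht]
  · infer_instance
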